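/- Let $p$ be a prime, let $D$ be a division ring of characteristic $p$ with center $C$, of finite dimension $n^2$ over $C$, and let $\delta\colon D\to D$ be a derivation. Put $F=\{c\in C:\delta(c)=0\}$, and suppose that the $F$-linear endomorphism $\delta|_C$ of $C$ is algebraic over $F$ with minimum polynomial of degree $p^e$. Let $R=D[t;\delta]$ be the differential polynomial ring (elements $\sum a_it^i$ with $a_i\in D$, product determined by $ta=at+\delta(a)$), and let $f\in R$ have degree $m\ge 2$. Let $S_f$ be the Petit algebra: the space $R_m=\{g\in R:\deg g<m\}$ with the product $g\circ h=$ the remainder $r$ of $gh=qf+r$, $\deg r<m$. For a nonassociative ring $A$ with associator $[x,y,z]=(xy)z-x(yz)$, write $\mathrm{Nuc}_l(A)=\{x:[x,A,A]=0\}$, $\mathrm{Nuc}_m(A)=\{x:[A,x,A]=0\}$, $\mathrm{Nuc}_r(A)=\{x:[A,A,x]=0\}$. Call $f$ semi-invariant if for every $a\in D$ there is $b\in D$ with $fa=bf$, and two-sided if moreover $ft=(ct+d)f$ for some $c,d\in D$. Call $A\neq 0$ a division algebra if left and right multiplication by every nonzero element are bijective. Then: (i) $S_f$ is a unital (nonassociative)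 $F$-algebra of dimension $mn^2p^e$, with unit the constant polynomial $1$. If $f$ is irreducible in $R$, then $S_f$ is a division algebra. If $f$ is not two-sided, then $\mathrm{Nuc}_l(S_f)=\mathrm{Nuc}_m(S_f)=D$ (the constant polynomials). Moreover $D\subseteq\mathrm{Nuc}_r(S_f)$ if and only if $f$ is semi-invariant; in particular $D$ is not contained in the right nucleus if $f$ is not semi-invariant. (ii) If $f\in F[t]$, then $q+(f)\mapsto q \bmod_r f$ is an injective unital homomorphism of $F$-algebras from $F[t]/(f)$ to $S_f$, with image $F\oplus Ft\oplus\dots\oplus Ft^{m-1}$, and this image is contained in $\mathrm{Nuc}_r(S_f)$. If moreover $f$ is irreducible in $F[t]$, then $F[t]/(f)$ is a field of degree $m$ over $F$. (iii) If $f\in C[t;\delta|_C]$, then the inclusion of coefficients $C\subseteq D$ induces an injective unital homomorphism of $F$-algebras from the Petit algebra $C[t;\delta|_C]/C[t;\delta|_C]f$ (formed over $C$) to $S_f$, and the former has dimension $mp^e$ over $F$. -/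

import Mathlib

open Polynomial

noncomputable section

/-- A derivation of a (not necessarily commutative) ring. -/
structure RingDer (D : Type*) [Ring D] extends D →+ D where
  leibniz' : ∀ a b, toFun (a * b) = a * toFun b + toFun a * b

namespace RingDer

instance {D : Type*} [Ring D] : CoeFun (RingDer D) (fun _ => D → D) := ⟨fun δ => δ.toAddMonoidHom⟩

section ring

variable {D : Type*} [Ring D] (δ : RingDer D)

theorem leibniz (a b : D) : δ (a * b) = a * δ b + δ a * b := δ.leibniz' a b

theorem map_one : δ 1 = 0 := by
  have h := δ.leibniz 1 1
  simpa using h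

theorem map_mem_center {c : D} (hc : c ∈ Subring.center D) : δ c ∈ Subring.center D := by
  rw [Subring.mem_center_iff] at hc ⊢
  intro g
  have h := congrArg δ (hc g)
  rw [δ.leibniz, δ.leibniz, hc (δ g), add_comm (c * δ g)] at h
  exact add_right_cancel h

/-- The restriction of a derivation to the center. -/
def toCenter : RingDer (Subring.center D) where
  toFun c := ⟨δ c, δ.map_mem_center c.2⟩
  map_zero' := Subtype.ext (map_zero δ.toAddMonoidHom)
  map_add' _ _ := Subtype.ext (map_add δ.toAddMonoidHom _ _)
  leibniz' _ _ := Subtype.ext (δ.leibniz _ _)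

end ring

section division

variable {D : Type*} [DivisionRing D] (δ : RingDer D)

/-- The field `F` of those central elements `c` of `D` with `δ c = 0`. -/
def constField : Subfield (Subring.center D) where
  carrier := {c | δ (c : D) = 0}
  mul_mem' {a b} ha hb := by
    change δ ((a : D) * b) = 0
    rw [δ.leibniz, show δ (a : D) = 0 from ha, show δ (b : D) = 0 from hb]; simp
  one_mem' := δ.map_one
  add_mem' {a b} ha hb := by
    change δ ((a : D) + b) = 0
    rw [map_add, show δ (a : D) = 0 from ha, show δ (b : D) = 0 from hb]; simp
  zero_mem' := map_zero δ.toAddMonoidHom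
  neg_mem' {a} ha := by
    change δ (-(a : D)) = 0
    rw [map_neg, show δ (a : D) = 0 from ha, neg_zero]
  inv_mem' a ha := by
    change δ ((a⁻¹ : Subring.center D) : D) = 0
    by_cases h0 : a = 0
    · subst h0; simp
    · have h1 : (a : D) * ((a⁻¹ : Subring.center D) : D) = 1 := by
        exact congrArg Subtype.val (mul_inv_cancel₀ h0)
      have h2 := congrArg δ h1
      rw [δ.leibniz, δ.map_one, show δ (a : D) = 0 from ha, zero_mul, add_zero] at h2
      have h3 : (a : D) ≠ 0 := fun h => h0 (Subtype.ext h)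
      exact (mul_eq_zero.mp h2).resolve_left h3

/-- The restriction of `δ` to the center `C` of `D`, as an `F`-linear endomorphism of `C`. -/
def centerLin : Module.End δ.constField (Subring.center D) where
  toFun := δ.toCenter
  map_add' := map_add δ.toCenter.toAddMonoidHom
  map_smul' c x := by
    change δ.toCenter ((c : Subring.center D) * x) = (c : Subring.center D) * δ.toCenter x
    have hc : δ.toCenter (c : Subring.center D) = 0 := Subtype.ext c.2
    rw [δ.toCenter.leibniz, hc, zero_mul, add_zero]

end division

end RingDer

/-- The differential polynomial ring `D[t;δ]`. Its elements are the polynomials `∑ aᵢ tⁱ` with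
coefficients on the left, with termwise addition; see `DiffPoly.mul_def` for the product. -/
def DiffPoly {D : Type*} [Ring D] (_δ : RingDer D) : Type _ := D[X]

namespace DiffPoly

section ring

variable {D : Type*} [Ring D] (δ : RingDer D)

theorem end_add (A B : AddMonoid.End D[X]) (x : D[X]) : (A + B) x = A x + B x := rfl

theorem end_mul (A B : AddMonoid.End D[X]) (x : D[X]) : (A * B) x = A (B x) := rfl

theorem end_zero (x : D[X]) : (0 : AddMonoid.End D[X]) x = 0 := rfl

theorem end_one (x : D[X]) : (1 : AddMonoid.End D[X]) x = x := rfl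

theorem end_sum (s : Finset ℕ) (A : ℕ → AddMonoid.End D[X]) (x : D[X]) :
    (∑ i ∈ s, A i) x = ∑ i ∈ s, A i x := by
  classical
  induction s using Finset.induction_on with
  | empty => rfl
  | insert a s ha ih => rw [Finset.sum_insert ha, Finset.sum_insert ha, end_add, ih]

/-- Left multiplication of polynomials by `t`: as `t a = a t + δ a`, it is
`∑ aᵢ tⁱ ↦ ∑ (aᵢ tⁱ⁺¹ + δ(aᵢ) tⁱ)`. -/
def tMul : AddMonoid.End D[X] where
  toFun g := g * X + g.sum fun i a => monomial i (δ a)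
  map_zero' := by simp
  map_add' g h := by
    rw [Polynomial.sum_add_index]
    · rw [add_mul]; abel
    · simp
    · simp

/-- Left multiplication of polynomials by a constant. -/
def cMul (a : D) : AddMonoid.End D[X] := AddMonoidHom.mulLeft (Polynomial.C a)

theorem cMul_apply (a : D) (g : D[X]) : cMul a g = Polynomial.C a * g := rfl

/-- Left multiplication by the differential polynomial `∑ aᵢ tⁱ`: the sum of the
`(left multiplication by aᵢ) ∘ (left multiplication by t)ⁱ`. -/
def lMul : D[X] →+ AddMonoid.End D[X] where
  toFun f := f.sum fun i a => cMul a * tMul δ ^ i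
  map_zero' := by simp
  map_add' f g := by
    refine Polynomial.sum_add_index _ _ _ (fun i => ?_) (fun i a b => ?_)
    · ext1 x; rw [end_mul, cMul_apply, Polynomial.C_0, zero_mul, end_zero]
    · rw [← add_mul]; congr 1; ext1 x
      rw [end_add, cMul_apply, cMul_apply, cMul_apply, Polynomial.C_add, add_mul]

theorem coeff_der (g : D[X]) (k : ℕ) :
    (g.sum fun i a => monomial i (δ a)).coeff k = δ (g.coeff k) := by
  rw [Polynomial.sum_def, finsetSum_coeff]
  simp only [coeff_monomial]
  rw [Finset.sum_ite_eq']
  split_ifs with h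
  · rfl
  · rw [notMem_support_iff.mp h, map_zero]

theorem tMul_apply (g : D[X]) :
    tMul δ g = g * X + g.sum fun i a => monomial i (δ a) := rfl

theorem coeff_tMul_succ (g : D[X]) (k : ℕ) :
    (tMul δ g).coeff (k + 1) = g.coeff k + δ (g.coeff (k + 1)) := by
  rw [tMul_apply, coeff_add, coeff_der, coeff_mul_X]

theorem tMul_cMul (a : D) : tMul δ * cMul a = cMul a * tMul δ + cMul (δ a) := by
  ext1 g
  ext k
  simp only [end_mul, end_add, cMul_apply, tMul_apply, coeff_add, coeff_C_mul, coeff_der,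
    δ.leibniz, mul_assoc, mul_add]
  abel

theorem tMul_monomial (i : ℕ) (a : D) :
    tMul δ (monomial i a) = monomial (i + 1) a + monomial i (δ a) := by
  rw [tMul_apply, monomial_mul_X, Polynomial.sum_monomial_index]
  exact (congrArg (monomial i) (map_zero δ.toAddMonoidHom)).trans (monomial_zero_right i)

theorem lMul_monomial (i : ℕ) (a : D) : lMul δ (monomial i a) = cMul a * tMul δ ^ i := by
  change ((monomial i a).sum fun i a => cMul a * tMul δ ^ i) = _
  rw [Polynomial.sum_monomial_index]
  ext1 x; rw [end_mul, cMul_apply, Polynomial.C_0, zero_mul, end_zero]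

theorem cMul_mul (a b : D) : cMul (a * b) = cMul a * cMul b := by
  ext1 g; rw [end_mul, cMul_apply, cMul_apply, cMul_apply, Polynomial.C_mul, mul_assoc]

theorem lMul_cMul (a : D) (g : D[X]) : lMul δ (cMul a g) = cMul a * lMul δ g := by
  induction g using Polynomial.induction_on' with
  | add p q hp hq => rw [map_add, map_add, map_add, hp, hq, mul_add]
  | monomial n b =>
    rw [cMul_apply, C_mul_monomial, lMul_monomial, lMul_monomial, cMul_mul, mul_assoc]

theorem lMul_tMul (g : D[X]) : lMul δ (tMul δ g) = tMul δ * lMul δ g := by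
  induction g using Polynomial.induction_on' with
  | add p q hp hq => rw [map_add, map_add, map_add, hp, hq, mul_add]
  | monomial n b =>
    rw [tMul_monomial, map_add, lMul_monomial, lMul_monomial, lMul_monomial, ← mul_assoc,
      tMul_cMul, pow_succ', add_mul, mul_assoc]

theorem lMul_lMul (f g : D[X]) : lMul δ (lMul δ f g) = lMul δ f * lMul δ g := by
  induction f using Polynomial.induction_on' with
  | add p q hp hq =>
    rw [map_add, end_add, map_add, hp, hq, add_mul]
  | monomial n b =>
    rw [lMul_monomial]
    have h : ∀ k : ℕ, lMul δ ((tMul δ ^ k) g) = tMul δ ^ k * lMul δ g := by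
      intro k
      induction k with
      | zero => simp
      | succ k ih =>
        rw [pow_succ', mul_assoc, ← ih, ← lMul_tMul]; rfl
    rw [mul_assoc, ← h, ← lMul_cMul]; rfl

theorem tMul_pow_one (k : ℕ) : (tMul δ ^ k) 1 = X ^ k := by
  induction k with
  | zero => simp
  | succ k ih =>
    have : (tMul δ ^ (k + 1)) 1 = tMul δ ((tMul δ ^ k) 1) := by rw [pow_succ']; rfl
    rw [this, ih, X_pow_eq_monomial, tMul_monomial, δ.map_one]
    simp [X_pow_eq_monomial]

theorem lMul_apply_one (f : D[X]) : lMul δ f 1 = f := by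
  induction f using Polynomial.induction_on' with
  | add p q hp hq => rw [map_add, end_add, hp, hq]
  | monomial n b =>
    rw [lMul_monomial]
    change cMul b ((tMul δ ^ n) 1) = _
    rw [tMul_pow_one, cMul_apply, C_mul_X_pow_eq_monomial]

theorem lMul_one : lMul δ 1 = 1 := by
  have h : (1 : D[X]) = monomial 0 1 := rfl
  rw [h, lMul_monomial]
  ext1 g; rw [pow_zero, mul_one, cMul_apply, Polynomial.C_1, one_mul, end_one]

variable {δ}

instance : AddCommGroup (DiffPoly δ) := inferInstanceAs (AddCommGroup D[X])

instance : Mul (DiffPoly δ) := ⟨fun f g => lMul δ f g⟩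

instance : One (DiffPoly δ) := ⟨(1 : D[X])⟩

instance : Ring (DiffPoly δ) where
  __ := (inferInstance : AddCommGroup (DiffPoly δ))
  mul f g := f * g
  one := 1
  left_distrib f g h := map_add (lMul δ f) g h
  right_distrib f g h := congrArg (fun A : AddMonoid.End D[X] => A h) (map_add (lMul δ) f g)
  zero_mul f := congrArg (fun A : AddMonoid.End D[X] => A f) (map_zero (lMul δ))
  mul_zero f := map_zero (lMul δ f)
  mul_assoc f g h := congrArg (fun A : AddMonoid.End D[X] => A h) (lMul_lMul δ f g)
  one_mul f := congrArg (fun A : AddMonoid.End D[X] => A f) (lMul_one δ)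
  mul_one f := lMul_apply_one δ f

/-- The differential polynomial with the same coefficients as a given polynomial. -/
def ofPoly (δ : RingDer D) : D[X] ≃+ DiffPoly δ := AddEquiv.refl _

/-- The underlying polynomial. -/
def toPoly : DiffPoly δ ≃+ D[X] := AddEquiv.refl _

theorem mul_def (f g : DiffPoly δ) : f * g = ofPoly δ (lMul δ f.toPoly g.toPoly) := rfl

/-- Constant differential polynomials. -/
def C (δ : RingDer D) (a : D) : DiffPoly δ := ofPoly δ (Polynomial.C a)

/-- The indeterminate `t`. -/
def t (δ : RingDer D) : DiffPoly δ := ofPoly δ X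

/-- The defining relation `t a = a t + δ a`. -/
theorem t_mul_C (a : D) : t δ * C δ a = C δ a * t δ + C δ (δ a) := by
  change lMul δ X (Polynomial.C a) = lMul δ (Polynomial.C a) X + Polynomial.C (δ a)
  rw [← monomial_one_one_eq_X, ← monomial_zero_left, lMul_monomial, lMul_monomial]
  simp only [pow_one, pow_zero, mul_one]
  change Polynomial.C 1 * tMul δ (monomial 0 a) = Polynomial.C a * monomial 1 1 + _
  rw [tMul_monomial]
  simp [C_mul_monomial]

/-- The degree (with value `0` at `0`). -/
def natDegree (f : DiffPoly δ) : ℕ := f.toPoly.natDegree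

/-- `f` is (right) semi-invariant: for every `a ∈ D` there is `b ∈ D` with `f a = b f`. -/
def IsSemiInvariant (f : DiffPoly δ) : Prop := ∀ a : D, ∃ b : D, f * C δ a = C δ b * f

/-- `f` is two-sided (invariant): it is semi-invariant and `f t = (c t + d) f` for some
`c, d ∈ D`. -/
def IsTwoSided (f : DiffPoly δ) : Prop :=
  f.IsSemiInvariant ∧ ∃ c d : D, f * t δ = (C δ c * t δ + C δ d) * f

/-- The inclusion `C[t;δ|_C] ⊆ D[t;δ]`, where `C` is the center of `D`. -/
def ofCenter (δ : RingDer D) (f : DiffPoly δ.toCenter) : DiffPoly δ :=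
  ofPoly δ (f.toPoly.map (Subring.center D).subtype)

end ring

section division

variable {D : Type*} [DivisionRing D] {δ : RingDer D}

/-- The inclusion `F[t] ⊆ D[t;δ]`. -/
def ofConst (δ : RingDer D) (f : (δ.constField)[X]) : DiffPoly δ :=
  ofPoly δ (f.map ((Subring.center D).subtype.comp δ.constField.subtype))

theorem top_tMul_pow (g : D[X]) (N : ℕ) (hN : ∀ i, N < i → g.coeff i = 0) (k : ℕ) :
    (∀ i, N + k < i → ((tMul δ ^ k) g).coeff i = 0) ∧
      ((tMul δ ^ k) g).coeff (N + k) = g.coeff N := by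
  induction k with
  | zero => simpa using hN
  | succ k ih =>
    have : (tMul δ ^ (k + 1)) g = tMul δ ((tMul δ ^ k) g) := by rw [pow_succ']; rfl
    rw [this]
    constructor
    · intro i hi
      obtain ⟨j, rfl⟩ : ∃ j, i = j + 1 := ⟨i - 1, by omega⟩
      rw [coeff_tMul_succ, ih.1 j (by omega), ih.1 (j + 1) (by omega), map_zero, add_zero]
    · rw [← add_assoc, coeff_tMul_succ, ih.2, ih.1 _ (Nat.lt_succ_self _), map_zero, add_zero]

theorem lMul_eq_sum (q f : D[X]) :
    lMul δ q f = ∑ i ∈ q.support, Polynomial.C (q.coeff i) * (tMul δ ^ i) f := by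
  change (q.sum fun i a => cMul a * tMul δ ^ i) f = _
  rw [Polynomial.sum_def, end_sum]
  rfl

theorem coeff_lMul_top (q f : D[X]) :
    (lMul δ q f).coeff (f.natDegree + q.natDegree) = q.leadingCoeff * f.leadingCoeff := by
  have hf : ∀ i, f.natDegree < i → f.coeff i = 0 := fun i => coeff_eq_zero_of_natDegree_lt
  rw [lMul_eq_sum, finsetSum_coeff, Finset.sum_eq_single q.natDegree]
  · rw [coeff_C_mul, (top_tMul_pow f _ hf _).2]; rfl
  · intro i hi hne
    have := le_natDegree_of_mem_supp i hi
    rw [coeff_C_mul, (top_tMul_pow f _ hf i).1 _ (by omega), mul_zero]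
  · intro h
    rw [coeff_C_mul, notMem_support_iff.mp h, zero_mul]

theorem eq_zero_of_mul_mem {q f : DiffPoly δ} (hf : f ≠ 0)
    (h : (q * f).toPoly ∈ degreeLT D f.natDegree) : q = 0 := by
  by_contra hq
  rw [mem_degreeLT] at h
  have h1 : ((q * f).toPoly).coeff (f.toPoly.natDegree + q.toPoly.natDegree) = 0 := by
    apply coeff_eq_zero_of_degree_lt
    refine h.trans_le ?_
    exact_mod_cast Nat.le_add_right _ _
  have h2 := coeff_lMul_top (δ := δ) q.toPoly f.toPoly
  rw [show lMul δ q.toPoly f.toPoly = (q * f).toPoly from rfl, h1] at h2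
  rcases mul_eq_zero.mp h2.symm with h3 | h3
  · exact hq (leadingCoeff_eq_zero.mp h3)
  · exact hf (leadingCoeff_eq_zero.mp h3)

/-- Right division with remainder. -/
theorem exists_rem {f : DiffPoly δ} (hf : f ≠ 0) (g : DiffPoly δ) :
    ∃ r : D[X], r ∈ degreeLT D f.natDegree ∧ ∃ q : DiffPoly δ, g = q * f + ofPoly δ r := by
  suffices H : ∀ N : ℕ, ∀ g : D[X], g.degree < N →
      ∃ r : D[X], r ∈ degreeLT D f.natDegree ∧ ∃ q : D[X], g = lMul δ q f.toPoly + r by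
    exact H (g.toPoly.natDegree + 1) g.toPoly
      (degree_le_natDegree.trans_lt (by exact_mod_cast Nat.lt_succ_self _))
  intro N
  induction N with
  | zero =>
    intro g hg
    exact ⟨g, mem_degreeLT.mpr (hg.trans_le (by simp)), 0, by
      rw [map_zero, end_zero, zero_add]⟩
  | succ N ih =>
    intro g hg
    by_cases hN : N < f.natDegree
    · exact ⟨g, mem_degreeLT.mpr (hg.trans_le (by exact_mod_cast hN)), 0, by
        rw [map_zero, end_zero, zero_add]⟩
    · obtain ⟨k, rfl⟩ := Nat.exists_eq_add_of_le (not_lt.mp hN)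
      have hlc : f.toPoly.leadingCoeff ≠ 0 := fun h => hf (leadingCoeff_eq_zero.mp h)
      set c : D := g.coeff (f.natDegree + k) * (f.toPoly.leadingCoeff)⁻¹ with hc
      have ht := top_tMul_pow (δ := δ) f.toPoly f.natDegree
        (fun i => coeff_eq_zero_of_natDegree_lt) k
      have hmon : lMul δ (monomial k c) f.toPoly = Polynomial.C c * (tMul δ ^ k) f.toPoly := by
        rw [lMul_monomial]; rfl
      obtain ⟨r, hr, q, hq⟩ := ih (g - lMul δ (monomial k c) f.toPoly) (by
        rw [degree_lt_iff_coeff_zero]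
        intro i hi
        rw [hmon, coeff_sub, coeff_C_mul]
        rcases hi.lt_or_eq with hi | hi
        · rw [ht.1 i hi, mul_zero, sub_zero]
          rw [degree_lt_iff_coeff_zero] at hg
          exact hg i hi
        · rw [← hi, ht.2, hc, show f.toPoly.coeff f.natDegree = f.toPoly.leadingCoeff from rfl,
            mul_assoc, inv_mul_cancel₀ hlc, mul_one, sub_self])
      refine ⟨r, hr, q + monomial k c, ?_⟩
      rw [map_add, end_add, add_right_comm, ← hq, sub_add_cancel]

end division

end DiffPoly

/-- The underlying space `R_m = {g ∈ D[t;δ] : deg g < m}`, `m = deg f`, of the Petit algebra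
`S_f` (for `f = 0` it is the zero space). -/
def Petit {D : Type*} [DivisionRing D] {δ : RingDer D} (f : DiffPoly δ) : Type _ :=
  degreeLT D f.natDegree

namespace Petit

variable {D : Type*} [DivisionRing D] {δ : RingDer D} {f : DiffPoly δ}

instance : AddCommGroup (Petit f) := inferInstanceAs (AddCommGroup (degreeLT D f.natDegree))

/-- Scalars act on the coefficients from the left. -/
instance {S : Type*} [Semiring S] [Module S D] [IsScalarTower S D D] : Module S (Petit f) :=
  inferInstanceAs (Module S (degreeLT D f.natDegree))

/-- A polynomial of degree less than `deg f`, as an element of `R_m`. -/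
def mk (r : D[X]) (hr : r ∈ degreeLT D f.natDegree) : Petit f := ⟨r, hr⟩

/-- The inclusion of `R_m` into `D[t;δ]`. -/
def val : Petit f →+ DiffPoly δ := (degreeLT D f.natDegree).subtype.toAddMonoidHom

theorem val_injective : Function.Injective (val : Petit f → DiffPoly δ) :=
  Subtype.val_injective

/-- The remainder `g mod_r f` of right division of `g` by `f`: `g = q f + (g mod_r f)` for some
`q`, with `deg (g mod_r f) < deg f` (with value `0` for `f = 0`). -/
def modr (f g : DiffPoly δ) : Petit f :=
  open Classical in
  if hf : f = 0 then 0 else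
    mk (Classical.choose (DiffPoly.exists_rem hf g))
      (Classical.choose_spec (DiffPoly.exists_rem hf g)).1

theorem modr_spec (hf : f ≠ 0) (g : DiffPoly δ) : ∃ q, g = q * f + val (modr f g) := by
  rw [modr, dif_neg hf]
  exact (Classical.choose_spec (DiffPoly.exists_rem hf g)).2

theorem modr_unique (hf : f ≠ 0) {g q : DiffPoly δ} {r : Petit f} (h : g = q * f + val r) :
    modr f g = r := by
  obtain ⟨q', hq'⟩ := modr_spec hf g
  have h1 : (q' - q) * f = val (r - modr f g) := by
    rw [sub_mul, map_sub, sub_eq_sub_iff_add_eq_add, ← hq', h, add_comm]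
  have h2 : q' - q = 0 := DiffPoly.eq_zero_of_mul_mem hf (by
    rw [h1]; exact (r - modr f g).2)
  rw [h2, zero_mul] at h1
  have h3 : r - modr f g = 0 := val_injective (by rw [← h1, map_zero])
  exact (sub_eq_zero.mp h3).symm

theorem subsingleton_of_natDegree (hf : f.natDegree = 0) : Subsingleton (Petit f) := by
  refine ⟨fun a b => Subtype.ext ?_⟩
  have h : ∀ x : Petit f, x.1 = 0 := by
    intro x
    have h1 : (x.1 : D[X]).degree < ((0 : ℕ) : WithBot ℕ) :=
      (mem_degreeLT.mp x.2).trans_eq (congrArg _ hf)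
    exact degree_eq_bot.mp (Nat.WithBot.lt_zero_iff.mp (by exact_mod_cast h1))
  exact (h a).trans (h b).symm

theorem modr_zero_left (hf : f = 0) (g : DiffPoly δ) : modr f g = 0 := by
  rw [modr, dif_pos hf]

theorem modr_add (g h : DiffPoly δ) : modr f (g + h) = modr f g + modr f h := by
  by_cases hf : f = 0
  · simp [modr_zero_left hf]
  · obtain ⟨q, hq⟩ := modr_spec hf g
    obtain ⟨q', hq'⟩ := modr_spec hf h
    refine modr_unique hf (q := q + q') ?_
    rw [add_mul, map_add]
    nth_rewrite 1 [hq, hq']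
    abel

theorem modr_val (x : Petit f) : modr f (val x) = x := by
  by_cases hf : f = 0
  · have : Subsingleton (Petit f) := subsingleton_of_natDegree (by rw [hf]; exact natDegree_zero)
    exact Subsingleton.elim _ _
  · exact modr_unique hf (q := 0) (by rw [zero_mul, zero_add])

theorem modr_zero : modr f 0 = 0 := by
  have h := modr_val (0 : Petit f)
  rwa [map_zero] at h

theorem val_modr_one (hf : f.natDegree ≠ 0) : val (modr f 1) = 1 := by
  have h : (1 : D[X]) ∈ degreeLT D f.natDegree := by
    rw [mem_degreeLT, degree_one]
    exact_mod_cast Nat.pos_of_ne_zero hf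
  have := modr_val (⟨1, h⟩ : Petit f)
  exact congrArg val this

/-- The Petit algebra `S_f`: the space `R_m` with the product `g ∘ h = g h mod_r f`. Its unit is
the remainder of `1`, which is the constant polynomial `1` when `deg f > 0`. -/
instance : NonAssocRing (Petit f) where
  __ := (inferInstance : AddCommGroup (Petit f))
  mul x y := modr f (val x * val y)
  one := modr f 1
  left_distrib x y z := by
    change modr f (val x * val (y + z)) = modr f (val x * val y) + modr f (val x * val z)
    rw [map_add, mul_add, modr_add]
  right_distrib x y z := by
    change modr f (val (x + y) * val z) = modr f (val x * val z) + modr f (val y * val z)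
    rw [map_add, add_mul, modr_add]
  zero_mul x := by
    change modr f (val 0 * val x) = 0
    rw [map_zero, zero_mul, modr_zero]
  mul_zero x := by
    change modr f (val x * val 0) = 0
    rw [map_zero, mul_zero, modr_zero]
  one_mul x := by
    change modr f (val (modr f 1) * val x) = x
    by_cases hf : f.natDegree = 0
    · have := subsingleton_of_natDegree hf
      exact Subsingleton.elim _ _
    · rw [val_modr_one hf, one_mul, modr_val]
  mul_one x := by
    change modr f (val x * val (modr f 1)) = x
    by_cases hf : f.natDegree = 0
    · have := subsingleton_of_natDegree hf
      exact Subsingleton.elim _ _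
    · rw [val_modr_one hf, mul_one, modr_val]

theorem mul_def (x y : Petit f) : x * y = modr f (val x * val y) := rfl

/-- The copy of `D` in `S_f`: the constant polynomials of degree less than `deg f`. -/
def constants (f : DiffPoly δ) : Set (Petit f) := {x | ∃ a : D, val x = DiffPoly.C δ a}

end Petit

/-- The left nucleus of a nonassociative ring. -/
def leftNucleus (A : Type*) [NonUnitalNonAssocRing A] : Set A :=
  {x | ∀ y z : A, associator x y z = 0}

/-- The middle nucleus of a nonassociative ring. -/
def middleNucleus (A : Type*) [NonUnitalNonAssocRing A] : Set A :=
  {x | ∀ y z : A, associator y x z = 0}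

/-- The right nucleus of a nonassociative ring. -/
def rightNucleus (A : Type*) [NonUnitalNonAssocRing A] : Set A :=
  {x | ∀ y z : A, associator y z x = 0}

/-- A nonassociative algebra `A ≠ 0` is a division algebra if left and right multiplication by
every nonzero element is bijective. -/
def IsNonassocDivision (A : Type*) [NonUnitalNonAssocRing A] : Prop :=
  Nontrivial A ∧ ∀ a : A, a ≠ 0 →
    Function.Bijective (fun x : A => a * x) ∧ Function.Bijective (fun x : A => x * a)

end

/-!
Write `S_f` for the quotient `R/Rf` of left `R`-modules, with remainders as representatives. If
`xy = qf + x ∘ y`, then `[x, y, z] = -(q f z mod_r f)`, so the associator detects whether `f z` lies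
in `Rf`. Whenever `deg x + deg y = deg f`, the quotient `q` is a nonzero constant, and
`[x, y, z] = 0` forces `f z ∈ Rf`. As every nonconstant `x` has such a partner `y` on either side,
all three nuclei are read off from the set of `z` with `f z ∈ Rf`.

For irreducible `f` the left ideal `Rf` is maximal. If `x ∘ y = 0` with `x, y ≠ 0`, then right
multiplication by `y` induces a surjection `R/Rx → R/Rf` of left `D`-spaces, contradicting
`deg x < deg f`. Finite dimensionality turns the absence of zero divisors into division.

Elements `v` of `C` that are independent over `F` have sequences `v, δ v, δ² v, …` that are
independent over `C`. These sequences satisfy the linear recurrence given by the minimum polynomial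
of `δ|_C`, whose solution space has dimension equal to its degree; hence `[C : F]` is at most this
degree, and equality follows from the Cayley–Hamilton theorem.
-/

section Derivation

variable {F K : Type*} [Field F] [Field K] [Algebra F K] (d : Derivation F K K)

theorem sum_derivation_smul_iterate_eq_zero {ι : Type*} {s : Finset ι} {c v : ι → K}
    (h : ∑ j ∈ s, c j • (fun i : ℕ => d^[i] (v j)) = 0) :
    ∑ j ∈ s, d (c j) • (fun i : ℕ => d^[i] (v j)) = 0 := by
  funext i
  have apply_at (k : ℕ) : ∑ j ∈ s, c j * d^[k] (v j) = 0 := by simpa using congrFun h k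
  have leibniz : ∑ j ∈ s, (c j * d^[i + 1] (v j) + d^[i] (v j) * d (c j)) = 0 := by
    simpa [Function.iterate_succ_apply'] using congrArg d (apply_at i)
  rw [Finset.sum_add_distrib, apply_at, zero_add] at leibniz
  simpa [mul_comm] using leibniz

variable {d}

/- The classical Wronskian argument: after normalising one coefficient of a shortest relation to
`1`, applying `d` shortens it further, so that all its coefficients are constants. -/
theorem linearIndependent_iterate_derivation (hd : ∀ a, d a = 0 → a ∈ (algebraMap F K).range)
    {ι : Type*} {v : ι → K} (hv : LinearIndependent F v) :
    LinearIndependent K fun j (i : ℕ) => d^[i] (v j) := by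
  classical
  rw [linearIndependent_iff']
  intro s
  induction s using Finset.induction_on with
  | empty => simp
  | insert a s ha ih =>
    intro c hc
    suffices hca : c a = 0 by
      rw [Finset.sum_insert ha, hca, zero_smul, zero_add] at hc
      simpa [hca] using ih c hc
    by_contra hca
    set b : ι → K := fun j => (c a)⁻¹ * c j
    have hba : b a = 1 := inv_mul_cancel₀ hca
    have hb : ∑ j ∈ insert a s, b j • (fun i : ℕ => d^[i] (v j)) = 0 := by
      simp only [b, mul_smul, ← Finset.smul_sum, hc, smul_zero]
    have derivative_eq_zero : ∀ j ∈ insert a s, d (b j) = 0 := by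
      have hdb := sum_derivation_smul_iterate_eq_zero d hb
      rw [Finset.sum_insert ha, hba, d.map_one_eq_zero, zero_smul, zero_add] at hdb
      simpa [hba] using ih _ hdb
    choose! k hk using fun j hj => hd _ (derivative_eq_zero j hj)
    have relation : ∑ j ∈ insert a s, k j • v j = 0 := by
      have := congrFun hb 0
      simp only [Finset.sum_apply, Pi.smul_apply, Function.iterate_zero, id, smul_eq_mul] at this
      rw [← Pi.zero_apply (M := fun _ : ℕ => K) 0, ← this]
      exact Finset.sum_congr rfl fun j hj => by rw [Algebra.smul_def, hk j hj]
    have hka := linearIndependent_iff'.mp hv _ k relation a (Finset.mem_insert_self a s)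
    simpa [hka, hba] using hk a (Finset.mem_insert_self a s)

variable (d) in
/-- The linear recurrence of the minimal polynomial of `d`, which is satisfied by the successive
derivatives `v, d v, d² v, …` of every element. -/
noncomputable def derivationRecurrence : LinearRecurrence K where
  order := (minpoly F (d : K →ₗ[F] K)).natDegree
  coeffs i := -algebraMap F K ((minpoly F (d : K →ₗ[F] K)).coeff i)

theorem iterate_mem_solSpace_derivationRecurrence (hint : IsIntegral F (d : K →ₗ[F] K)) (v : K) :
    (fun i : ℕ => d^[i] v) ∈ (derivationRecurrence d).solSpace := by
  intro n
  have h := congrArg (fun φ : Module.End F K => φ (d^[n] v)) (minpoly.aeval F (d : K →ₗ[F] K))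
  simp only [aeval_eq_sum_range, Finset.sum_range_succ, (minpoly.monic hint).coeff_natDegree] at h
  simp only [LinearMap.add_apply, LinearMap.sum_apply, LinearMap.smul_apply, Module.End.pow_apply,
    one_smul, LinearMap.zero_apply, Derivation.coeFn_coe, ← Function.iterate_add_apply] at h
  change d^[n + (minpoly F (d : K →ₗ[F] K)).natDegree] v =
    ∑ i : Fin (minpoly F (d : K →ₗ[F] K)).natDegree,
      -algebraMap F K ((minpoly F (d : K →ₗ[F] K)).coeff i) * d^[n + i] v
  simp only [neg_mul, Finset.sum_neg_distrib, ← Algebra.smul_def, add_comm n]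
  rwa [eq_neg_iff_add_eq_zero, add_comm,
    Fin.sum_univ_eq_sum_range (fun i => (minpoly F (d : K →ₗ[F] K)).coeff i • d^[i + n] v)]

theorem rank_le_natDegree_minpoly_derivation (hd : ∀ a, d a = 0 → a ∈ (algebraMap F K).range)
    (hint : IsIntegral F (d : K →ₗ[F] K)) :
    Module.rank F K ≤ (minpoly F (d : K →ₗ[F] K)).natDegree := by
  let B := Module.Basis.ofVectorSpace F K
  have independent : LinearIndependent K fun j =>
      (⟨_, iterate_mem_solSpace_derivationRecurrence hint (B j)⟩ :
        (derivationRecurrence d).solSpace) :=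
    .of_comp (derivationRecurrence d).solSpace.subtype
      (linearIndependent_iterate_derivation hd B.linearIndependent)
  rw [← B.mk_eq_rank'']
  exact independent.cardinal_le_rank.trans_eq (LinearRecurrence.solSpace_rank _)

theorem finiteDimensional_of_isIntegral_derivation
    (hd : ∀ a, d a = 0 → a ∈ (algebraMap F K).range) (hint : IsIntegral F (d : K →ₗ[F] K)) :
    FiniteDimensional F K :=
  Module.rank_lt_aleph0_iff.mp
    ((rank_le_natDegree_minpoly_derivation hd hint).trans_lt Cardinal.natCast_lt_aleph0)

theorem finrank_eq_natDegree_minpoly_derivation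
    (hd : ∀ a, d a = 0 → a ∈ (algebraMap F K).range) (hint : IsIntegral F (d : K →ₗ[F] K)) :
    Module.finrank F K = (minpoly F (d : K →ₗ[F] K)).natDegree := by
  have := finiteDimensional_of_isIntegral_derivation hd hint
  refine le_antisymm
    (Module.finrank_le_of_rank_le (rank_le_natDegree_minpoly_derivation hd hint)) ?_
  rw [← LinearMap.charpoly_natDegree (d : K →ₗ[F] K)]
  exact natDegree_le_of_dvd (LinearMap.minpoly_dvd_charpoly _) (LinearMap.charpoly_monic _).ne_zero

end Derivation

namespace RingDer

variable {D : Type*} [DivisionRing D] (δ : RingDer D)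

/-- The restriction of `δ` to the center, as a derivation over the constants. -/
noncomputable def centerDerivation :
    Derivation δ.constField (Subring.center D) (Subring.center D) :=
  .mk' δ.centerLin fun a b =>
    (δ.toCenter.leibniz a b).trans (congrArg _ (mul_comm (δ.toCenter a) b))

theorem coe_centerDerivation :
    (δ.centerDerivation : Module.End δ.constField (Subring.center D)) = δ.centerLin :=
  rfl

theorem mem_range_algebraMap_of_centerDerivation_eq_zero (a : Subring.center D)
    (ha : δ.centerDerivation a = 0) :
    a ∈ (algebraMap δ.constField (Subring.center D)).range :=
  ⟨⟨a, congrArg Subtype.val ha⟩, rfl⟩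

variable {δ}

theorem finiteDimensional_center (hδ : IsAlgebraic δ.constField δ.centerLin) :
    FiniteDimensional δ.constField (Subring.center D) :=
  finiteDimensional_of_isIntegral_derivation δ.mem_range_algebraMap_of_centerDerivation_eq_zero
    hδ.isIntegral

theorem finrank_center (hδ : IsAlgebraic δ.constField δ.centerLin) :
    Module.finrank δ.constField (Subring.center D) =
      (minpoly δ.constField δ.centerLin).natDegree := by
  rw [← δ.coe_centerDerivation]
  exact finrank_eq_natDegree_minpoly_derivation
    δ.mem_range_algebraMap_of_centerDerivation_eq_zero (δ.coe_centerDerivation ▸ hδ.isIntegral)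

end RingDer

theorem isMaximal_span_singleton_of_irreducible {R : Type*} [Ring R] [IsDomain R]
    [IsPrincipalIdealRing R] {f : R} (hf : Irreducible f) : (Ideal.span {f}).IsMaximal := by
  refine ⟨fun htop => hf.not_isUnit ?_, fun I hI => ?_⟩
  · obtain ⟨a, ha⟩ := Ideal.mem_span_singleton'.mp (htop ▸ Submodule.mem_top (x := (1 : R)))
    exact .of_mul_eq_one_right a ha
  · obtain ⟨g, rfl⟩ := IsPrincipalIdealRing.principal I
    obtain ⟨a, rfl⟩ := Ideal.mem_span_singleton'.mp
      (hI.le (Ideal.mem_span_singleton_self f))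
    rcases hf.isUnit_or_isUnit rfl with ha | hg
    · refine absurd ?_ hI.not_ge
      rw [Ideal.span_singleton_mul_left_unit ha]
    · exact Ideal.eq_top_of_isUnit_mem _ (Ideal.mem_span_singleton_self g) hg

theorem isNonassocDivision_of_finiteDimensional (K : Type*) {A : Type*} [Field K]
    [NonUnitalNonAssocRing A] [Module K A] [IsScalarTower K A A] [SMulCommClass K A A]
    [FiniteDimensional K A] [Nontrivial A] [NoZeroDivisors A] : IsNonassocDivision A := by
  refine ⟨inferInstance, fun a ha => ⟨?_, ?_⟩⟩
  · have injective : Function.Injective (LinearMap.mulLeft K a) :=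
      LinearMap.ker_eq_bot.mp (LinearMap.ker_eq_bot'.mpr fun x hx =>
        (mul_eq_zero.mp hx).resolve_left ha)
    exact ⟨injective, LinearMap.surjective_of_injective injective⟩
  · have injective : Function.Injective (LinearMap.mulRight K a) :=
      LinearMap.ker_eq_bot.mp (LinearMap.ker_eq_bot'.mpr fun x hx =>
        (mul_eq_zero.mp hx).resolve_right ha)
    exact ⟨injective, LinearMap.surjective_of_injective injective⟩

namespace DiffPoly

section Ring

variable {A D : Type*} [Ring A] [Ring D] {ε : RingDer A} {δ : RingDer D}

theorem toPoly_C_mul (a : D) (g : DiffPoly δ) :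
    (C δ a * g).toPoly = Polynomial.C a * g.toPoly := by
  change lMul δ (Polynomial.C a) g.toPoly = _
  rw [← monomial_zero_left, lMul_monomial, pow_zero, mul_one, cMul_apply, monomial_zero_left]

theorem toPoly_t_pow_mul (k : ℕ) (g : DiffPoly δ) :
    (t δ ^ k * g).toPoly = (tMul δ ^ k) g.toPoly := by
  have toPoly_t_mul (h : DiffPoly δ) : (t δ * h).toPoly = tMul δ h.toPoly := by
    change lMul δ X h.toPoly = _
    rw [← monomial_one_one_eq_X, lMul_monomial, pow_one, end_mul, cMul_apply, Polynomial.C_1,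
      one_mul]
  induction k with
  | zero => rw [pow_zero, one_mul, pow_zero, end_one]
  | succ k ih => rw [pow_succ', mul_assoc, toPoly_t_mul, ih, pow_succ', end_mul]

theorem toPoly_t_pow (k : ℕ) : (t δ ^ k).toPoly = X ^ k := by
  rw [← tMul_pow_one δ, ← mul_one (t δ ^ k), toPoly_t_pow_mul]
  rfl

theorem ofPoly_monomial (k : ℕ) (a : D) : ofPoly δ (monomial k a) = C δ a * t δ ^ k := by
  apply toPoly.injective
  rw [toPoly_C_mul, toPoly_t_pow, C_mul_X_pow_eq_monomial]
  rfl

theorem C_zero : C δ 0 = 0 := Polynomial.C_0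

theorem C_one : C δ 1 = 1 := rfl

theorem C_mul (a b : D) : C δ (a * b) = C δ a * C δ b := by
  apply toPoly.injective
  rw [toPoly_C_mul]
  exact Polynomial.C_mul

@[elab_as_elim]
theorem induction_on {P : DiffPoly δ → Prop} (f : DiffPoly δ) (C : ∀ a, P (C δ a)) (t : P (t δ))
    (add : ∀ g h, P g → P h → P (g + h)) (mul : ∀ g h, P g → P h → P (g * h)) : P f := by
  have pow (k : ℕ) : P (DiffPoly.t δ ^ k) := by
    induction k with
    | zero => rw [pow_zero, ← C_one]; exact C 1
    | succ k ih => rw [pow_succ]; exact mul _ _ ih t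
  suffices ∀ q : D[X], P (ofPoly δ q) from this f.toPoly
  intro q
  induction q using Polynomial.induction_on' with
  | add q r hq hr => rw [map_add]; exact add _ _ hq hr
  | monomial k a => rw [ofPoly_monomial]; exact mul _ _ (C a) (pow k)

instance [Nontrivial D] : Nontrivial (DiffPoly δ) := inferInstanceAs (Nontrivial D[X])

theorem C_ne_zero {a : D} : C δ a ≠ 0 ↔ a ≠ 0 := Polynomial.C_ne_zero

theorem t_ne_zero [Nontrivial D] : t δ ≠ 0 := X_ne_zero

theorem natDegree_C (a : D) : (C δ a).natDegree = 0 := Polynomial.natDegree_C a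

theorem natDegree_zero : (0 : DiffPoly δ).natDegree = 0 := Polynomial.natDegree_zero

theorem natDegree_t_pow [Nontrivial D] (k : ℕ) : (t δ ^ k).natDegree = k := by
  change (t δ ^ k).toPoly.natDegree = k
  rw [toPoly_t_pow, natDegree_X_pow]

theorem natDegree_t [Nontrivial D] : (t δ).natDegree = 1 := natDegree_X

theorem natDegree_sub_le (f g : DiffPoly δ) :
    (f - g).natDegree ≤ max f.natDegree g.natDegree :=
  Polynomial.natDegree_sub_le f.toPoly g.toPoly

theorem toPoly_mem_degreeLT_iff {g : DiffPoly δ} {k : ℕ} (hk : k ≠ 0) :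
    g.toPoly ∈ degreeLT D k ↔ g.natDegree < k := by
  rw [mem_degreeLT]
  by_cases hg : g.toPoly = 0
  · simp [hg, natDegree, Nat.pos_of_ne_zero hk]
  · exact (natDegree_lt_iff_degree_lt hg).symm

theorem exists_eq_C_of_natDegree_eq_zero {g : DiffPoly δ} (hg : g.natDegree = 0) :
    ∃ a, g = C δ a :=
  ⟨_, eq_C_of_natDegree_eq_zero hg⟩

theorem exists_eq_C_mul_t_add_C_of_natDegree_le_one {g : DiffPoly δ} (hg : g.natDegree ≤ 1) :
    ∃ a b, g = C δ a * t δ + C δ b := by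
  refine ⟨g.toPoly.coeff 1, g.toPoly.coeff 0, toPoly.injective ?_⟩
  rw [map_add, toPoly_C_mul]
  exact eq_X_add_C_of_natDegree_le_one hg

variable {φ : A →+* D}

theorem map_tMul (hφ : ∀ a, φ (ε a) = δ (φ a)) (g : A[X]) :
    (tMul ε g).map φ = tMul δ (g.map φ) := by
  ext k
  simp only [tMul_apply, Polynomial.map_add, Polynomial.map_mul, map_X, coeff_add, coeff_der,
    coeff_map, hφ]

theorem map_lMul (hφ : ∀ a, φ (ε a) = δ (φ a)) (f g : A[X]) :
    (lMul ε f g).map φ = lMul δ (f.map φ) (g.map φ) := by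
  have map_tMul_pow (k : ℕ) : ((tMul ε ^ k) g).map φ = (tMul δ ^ k) (g.map φ) := by
    induction k with
    | zero => rw [pow_zero, pow_zero, end_one, end_one]
    | succ k ih => rw [pow_succ', pow_succ', end_mul, end_mul, map_tMul hφ, ih]
  induction f using Polynomial.induction_on' with
  | add p q hp hq => simp only [map_add, end_add, Polynomial.map_add, hp, hq]
  | monomial k a =>
    rw [map_monomial, lMul_monomial, lMul_monomial, end_mul, end_mul, cMul_apply, cMul_apply,
      Polynomial.map_mul, map_C, map_tMul_pow]

/-- The homomorphism `A[t;ε] → D[t;δ]` induced by a ring homomorphism `A → D` that intertwines the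
derivations. -/
noncomputable def map (φ : A →+* D) (hφ : ∀ a, φ (ε a) = δ (φ a)) :
    DiffPoly ε →+* DiffPoly δ where
  toFun f := ofPoly δ (f.toPoly.map φ)
  map_zero' := Polynomial.map_zero φ
  map_one' := Polynomial.map_one φ
  map_add' _ _ := Polynomial.map_add φ
  map_mul' f g := map_lMul hφ f.toPoly g.toPoly

theorem map_injective (hφ : ∀ a, φ (ε a) = δ (φ a)) (hφ_inj : Function.Injective φ) :
    Function.Injective (map φ hφ) :=
  Polynomial.map_injective φ hφ_inj

theorem natDegree_map (hφ : ∀ a, φ (ε a) = δ (φ a)) (hφ_inj : Function.Injective φ)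
    (f : DiffPoly ε) : (map φ hφ f).natDegree = f.natDegree :=
  natDegree_map_eq_of_injective hφ_inj f.toPoly

end Ring

section DivisionRing

variable {D : Type*} [DivisionRing D] {δ : RingDer D} {f g : DiffPoly δ}

instance : NoZeroDivisors (DiffPoly δ) where
  eq_zero_or_eq_zero_of_mul_eq_zero {q f} hqf := or_iff_not_imp_right.mpr fun hf =>
    eq_zero_of_mul_mem hf (by rw [hqf]; exact Submodule.zero_mem _)

instance : IsDomain (DiffPoly δ) := NoZeroDivisors.to_isDomain _

theorem natDegree_mul_le (f g : DiffPoly δ) :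
    (f * g).natDegree ≤ f.natDegree + g.natDegree := by
  refine natDegree_le_iff_coeff_eq_zero.mpr fun k hk => ?_
  change (lMul δ f.toPoly g.toPoly).coeff k = 0
  rw [lMul_eq_sum, finsetSum_coeff]
  refine Finset.sum_eq_zero fun i hi => ?_
  have hif : i ≤ f.natDegree := le_natDegree_of_mem_supp i hi
  have vanishes := (top_tMul_pow (δ := δ) g.toPoly g.natDegree
    (fun _ => coeff_eq_zero_of_natDegree_lt) i).1 k (by omega)
  rw [coeff_C_mul, vanishes, mul_zero]

theorem natDegree_mul (hf : f ≠ 0) (hg : g ≠ 0) :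
    (f * g).natDegree = f.natDegree + g.natDegree := by
  refine le_antisymm (natDegree_mul_le f g) ?_
  rw [add_comm]
  refine le_natDegree_of_ne_zero (ne_of_eq_of_ne (coeff_lMul_top f.toPoly g.toPoly) ?_)
  exact mul_ne_zero (leadingCoeff_ne_zero.mpr hf) (leadingCoeff_ne_zero.mpr hg)

theorem exists_eq_mul_add_natDegree_lt (hg : g ≠ 0) (f : DiffPoly δ) :
    ∃ q r, f = q * g + r ∧ (r = 0 ∨ r.natDegree < g.natDegree) := by
  obtain ⟨r, hr, q, hq⟩ := exists_rem hg f
  refine ⟨q, ofPoly δ r, hq, or_iff_not_imp_left.mpr fun hr0 => ?_⟩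
  exact (natDegree_lt_iff_degree_lt hr0).mpr (mem_degreeLT.mp hr)

instance : IsPrincipalIdealRing (DiffPoly δ) where
  principal I := by
    by_cases hI : I = ⊥
    · exact ⟨0, by rw [hI, Submodule.span_zero_singleton]⟩
    obtain ⟨g, ⟨hgI, hg⟩, hmin⟩ := exists_minimalFor_of_wellFoundedLT
      (fun g : DiffPoly δ => g ∈ I ∧ g ≠ 0) natDegree (Submodule.exists_mem_ne_zero_of_ne_bot hI)
    refine ⟨g, le_antisymm (fun f hf => ?_) (Ideal.span_le.mpr (Set.singleton_subset_iff.mpr hgI))⟩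
    obtain ⟨q, r, hqr, hr⟩ := exists_eq_mul_add_natDegree_lt hg f
    have hrI : r ∈ I := (I.add_mem_iff_right (I.mul_mem_left q hgI)).mp (hqr ▸ hf)
    have hr0 : r = 0 := by
      by_contra hr0
      have hlt := hr.resolve_left hr0
      exact hlt.not_ge (hmin ⟨hrI, hr0⟩ hlt.le)
    exact Ideal.mem_span_singleton'.mpr ⟨q, by rw [hqr, hr0, add_zero]⟩

theorem exists_natDegree_le_of_mul_mem_span (hfg : f * g ∈ Ideal.span {f}) :
    ∃ s : DiffPoly δ, s.natDegree ≤ g.natDegree ∧ f * g = s * f := by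
  obtain ⟨s, hs⟩ := Ideal.mem_span_singleton'.mp hfg
  by_cases hfg0 : f * g = 0
  · exact ⟨0, by rw [natDegree_zero]; exact Nat.zero_le _, by rw [hfg0, zero_mul]⟩
  · have hsf0 : s * f ≠ 0 := hs ▸ hfg0
    have hdeg := congrArg natDegree hs
    rw [natDegree_mul (left_ne_zero_of_mul hsf0) (right_ne_zero_of_mul hsf0),
      natDegree_mul (left_ne_zero_of_mul hfg0) (right_ne_zero_of_mul hfg0)] at hdeg
    exact ⟨s, by omega, hs.symm⟩

theorem isSemiInvariant_iff : f.IsSemiInvariant ↔ ∀ a, f * C δ a ∈ Ideal.span {f} := by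
  refine forall_congr' fun a => ⟨fun ⟨b, hb⟩ => ?_, fun ha => ?_⟩
  · exact Ideal.mem_span_singleton'.mpr ⟨C δ b, hb.symm⟩
  · obtain ⟨s, hdeg, hs⟩ := exists_natDegree_le_of_mul_mem_span ha
    obtain ⟨b, rfl⟩ := exists_eq_C_of_natDegree_eq_zero
      (Nat.le_zero.mp (natDegree_C (δ := δ) a ▸ hdeg))
    exact ⟨b, hs⟩

theorem isTwoSided_of_mul_mem_span (hC : ∀ a, f * C δ a ∈ Ideal.span {f})
    (ht : f * t δ ∈ Ideal.span {f}) : f.IsTwoSided := by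
  refine ⟨isSemiInvariant_iff.mpr hC, ?_⟩
  obtain ⟨s, hdeg, hs⟩ := exists_natDegree_le_of_mul_mem_span ht
  obtain ⟨c, d, rfl⟩ := exists_eq_C_mul_t_add_C_of_natDegree_le_one (natDegree_t (δ := δ) ▸ hdeg)
  exact ⟨c, d, hs⟩

theorem commute_C (c : δ.constField) (g : DiffPoly δ) : Commute (C δ c) g := by
  induction g using induction_on with
  | C a =>
    have hca : (c : D) * a = a * c := ((Subring.mem_center_iff.mp c.1.2) a).symm
    rw [Commute, SemiconjBy, ← C_mul, ← C_mul, hca]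
  | t =>
    have hc : δ c = 0 := c.2
    rw [Commute, SemiconjBy, t_mul_C, hc, C_zero, add_zero]
  | add g h hg hh => exact hg.add_right hh
  | mul g h hg hh => exact hg.mul_right hh

theorem ofConst_injective : Function.Injective (ofConst δ) :=
  Polynomial.map_injective _ (RingHom.injective _)

theorem natDegree_ofConst (p : δ.constField[X]) : (ofConst δ p).natDegree = p.natDegree :=
  natDegree_map_eq_of_injective (RingHom.injective _) p

theorem ofConst_zero : ofConst δ 0 = 0 := Polynomial.map_zero _

theorem ofConst_one : ofConst δ 1 = 1 := Polynomial.map_one _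

theorem ofConst_add (p q : δ.constField[X]) :
    ofConst δ (p + q) = ofConst δ p + ofConst δ q :=
  Polynomial.map_add _

theorem ofConst_monomial (k : ℕ) (c : δ.constField) :
    ofConst δ (monomial k c) = C δ c * t δ ^ k := by
  rw [← ofPoly_monomial, ofConst, map_monomial]
  rfl

theorem ofConst_mul (p q : δ.constField[X]) :
    ofConst δ (p * q) = ofConst δ p * ofConst δ q := by
  induction p using Polynomial.induction_on' with
  | add p₁ p₂ h₁ h₂ => rw [add_mul, ofConst_add, ofConst_add, add_mul, h₁, h₂]
  | monomial i a =>
    induction q using Polynomial.induction_on' with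
    | add q₁ q₂ h₁ h₂ => rw [mul_add, ofConst_add, ofConst_add, mul_add, h₁, h₂]
    | monomial j b =>
      have C_mul_coe : C δ (a * b : δ.constField) = C δ a * C δ b := C_mul (a : D) b
      rw [monomial_mul_monomial, ofConst_monomial, ofConst_monomial, ofConst_monomial, C_mul_coe,
        pow_add, mul_assoc, mul_assoc, ← mul_assoc (t δ ^ i), ← (commute_C b (t δ ^ i)).eq,
        mul_assoc]

theorem commute_ofConst (p q : δ.constField[X]) : Commute (ofConst δ p) (ofConst δ q) := by
  rw [Commute, SemiconjBy, ← ofConst_mul, mul_comm, ofConst_mul]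

end DivisionRing

end DiffPoly

namespace Petit

section Module

variable {D : Type*} [DivisionRing D] {δ : RingDer D}
  (S : Type*) [Semiring S] [Module S D] [IsScalarTower S D D] (f : DiffPoly δ)

/-- An element of `S_f` as the vector of its `deg f` coefficients. -/
noncomputable def coeffEquiv : Petit f ≃ₗ[S] (Fin f.natDegree → D) :=
  (degreeLTEquiv D f.natDegree).restrictScalars S

instance finite [Module.Finite S D] : Module.Finite S (Petit f) :=
  .equiv (coeffEquiv S f).symm

theorem finrank_eq [StrongRankCondition S] [Module.Free S D] [Module.Finite S D] :
    Module.finrank S (Petit f) = f.natDegree * Module.finrank S D := by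
  rw [(coeffEquiv S f).finrank_eq, Module.finrank_pi_fintype, Finset.sum_const, Finset.card_univ,
    Fintype.card_fin, smul_eq_mul]

instance : IsScalarTower S D (Petit f) :=
  inferInstanceAs (IsScalarTower S D (degreeLT D f.natDegree))

end Module

section Remainder

variable {D : Type*} [DivisionRing D] {δ : RingDer D} {f g h : DiffPoly δ}

theorem val_eq_zero_iff {x : Petit f} : val x = 0 ↔ x = 0 :=
  map_eq_zero_iff val val_injective

theorem natDegree_val_lt (hf : f.natDegree ≠ 0) (x : Petit f) :
    (val x).natDegree < f.natDegree :=
  (DiffPoly.toPoly_mem_degreeLT_iff hf).mp x.2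

theorem val_modr_of_natDegree_lt (hg : g.natDegree < f.natDegree) : val (modr f g) = g :=
  congrArg val (modr_val (mk g.toPoly ((DiffPoly.toPoly_mem_degreeLT_iff hg.ne_bot).mpr hg)))

theorem modr_sub (g h : DiffPoly δ) : modr f (g - h) = modr f g - modr f h :=
  eq_sub_of_add_eq (by rw [← modr_add, sub_add_cancel])

theorem modr_mul_self (q : DiffPoly δ) : modr f (q * f) = 0 := by
  by_cases hf : f = 0
  · exact modr_zero_left hf _
  · exact modr_unique hf (by rw [map_zero, add_zero])

theorem modr_eq_zero_of_mem_span (hg : g ∈ Ideal.span {f}) : modr f g = 0 := by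
  obtain ⟨q, rfl⟩ := Ideal.mem_span_singleton'.mp hg
  exact modr_mul_self q

theorem modr_eq_zero_iff (hf : f ≠ 0) : modr f g = 0 ↔ g ∈ Ideal.span {f} := by
  refine ⟨fun hg => ?_, modr_eq_zero_of_mem_span⟩
  obtain ⟨q, hq⟩ := modr_spec hf g
  exact Ideal.mem_span_singleton'.mpr ⟨q, by rw [hq, hg, map_zero, add_zero]⟩

theorem modr_mul_modr (g h : DiffPoly δ) : modr f (g * val (modr f h)) = modr f (g * h) := by
  by_cases hf : f = 0
  · rw [modr_zero_left hf, modr_zero_left hf]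
  obtain ⟨q, hq⟩ := modr_spec hf h
  rw [← zero_add (modr f (g * val _)), ← modr_mul_self (g * q), ← modr_add, mul_assoc, ← mul_add,
    ← hq]

theorem modr_mul_of_mul_mem_span (hfh : f * h ∈ Ideal.span {f}) (g : DiffPoly δ) :
    modr f (g * h) = modr f g * modr f h := by
  by_cases hf : f = 0
  · rw [modr_zero_left hf, modr_zero_left hf, zero_mul]
  obtain ⟨q, hq⟩ := modr_spec hf g
  have hqfh : modr f (q * f * h) = 0 := by
    rw [mul_assoc]
    exact modr_eq_zero_of_mem_span (Ideal.mul_mem_left _ q hfh)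
  rw [mul_def, modr_mul_modr]
  nth_rewrite 1 [hq]
  rw [add_mul, modr_add, hqfh, zero_add]

theorem val_smul (c : D) (x : Petit f) : val (c • x) = DiffPoly.C δ c * val x := by
  apply DiffPoly.toPoly.injective
  rw [DiffPoly.toPoly_C_mul, ← smul_eq_C_mul]
  rfl

theorem modr_C_mul (c : D) (g : DiffPoly δ) : modr f (DiffPoly.C δ c * g) = c • modr f g := by
  rw [← modr_mul_modr, ← val_smul, modr_val]

end Remainder

section Algebra

variable {D : Type*} [DivisionRing D] {δ : RingDer D} {f : DiffPoly δ}

instance {S : Type*} [Semiring S] [Module S D] [IsScalarTower S D D] :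
    IsScalarTower S (Petit f) (Petit f) where
  smul_assoc c x y := by
    rw [← smul_one_smul D c x, ← smul_one_smul D c (x • y), smul_eq_mul, smul_eq_mul, mul_def,
      mul_def, val_smul, mul_assoc, modr_C_mul]

instance : SMulCommClass δ.constField (Petit f) (Petit f) where
  smul_comm c x y := by
    change (c : D) • (x * y) = x * ((c : D) • y)
    rw [mul_def, mul_def, val_smul, ← mul_assoc, ← (DiffPoly.commute_C c (val x)).eq, mul_assoc,
      modr_C_mul]

theorem nontrivial (hf : f.natDegree ≠ 0) : Nontrivial (Petit f) :=
  ⟨1, 0, fun h => one_ne_zero (α := DiffPoly δ) <| by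
    rw [← val_modr_one hf, val_eq_zero_iff]; exact h⟩

end Algebra

section Nuclei

variable {D : Type*} [DivisionRing D] {δ : RingDer D} {f : DiffPoly δ} {x y z : Petit f}

theorem associator_eq_neg_modr {q : DiffPoly δ} (hq : val x * val y = q * f + val (x * y)) :
    associator x y z = -modr f (q * f * val z) := by
  rw [associator_apply, ← neg_sub, mul_def (x * y), mul_def x (y * z), mul_def y, modr_mul_modr,
    ← modr_sub, ← mul_assoc, hq, add_mul, add_sub_cancel_right]

theorem associator_eq_zero_of_natDegree_lt (h : (val x * val y).natDegree < f.natDegree) :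
    associator x y z = 0 := by
  rw [associator_eq_neg_modr (q := 0), zero_mul, zero_mul, modr_zero, neg_zero]
  rw [zero_mul, zero_add, mul_def, val_modr_of_natDegree_lt h]

theorem exists_eq_C_mul_add_val {g : DiffPoly δ} (hf : f.natDegree ≠ 0)
    (hg : g.natDegree = f.natDegree) :
    ∃ a ≠ 0, g = DiffPoly.C δ a * f + val (modr f g) := by
  have hf0 : f ≠ 0 := ne_of_apply_ne DiffPoly.natDegree (hf.trans_eq DiffPoly.natDegree_zero.symm)
  obtain ⟨q, hq⟩ := modr_spec hf0 g
  have hr := natDegree_val_lt hf (modr f g)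
  have hq0 : q ≠ 0 := by
    rintro rfl
    rw [zero_mul, zero_add] at hq
    exact hr.ne (hq ▸ hg)
  have hqf : (q * f).natDegree ≤ f.natDegree := by
    rw [← sub_eq_iff_eq_add.mpr hq]
    exact (DiffPoly.natDegree_sub_le _ _).trans (max_le hg.le hr.le)
  rw [DiffPoly.natDegree_mul hq0 hf0] at hqf
  obtain ⟨a, rfl⟩ := DiffPoly.exists_eq_C_of_natDegree_eq_zero (g := q) (by omega)
  exact ⟨a, DiffPoly.C_ne_zero.mp hq0, hq⟩

theorem mul_val_mem_span_of_associator_eq_zero (hf : f.natDegree ≠ 0)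
    (hdeg : (val x * val y).natDegree = f.natDegree) (hxyz : associator x y z = 0) :
    f * val z ∈ Ideal.span {f} := by
  have hf0 : f ≠ 0 := ne_of_apply_ne DiffPoly.natDegree (hf.trans_eq DiffPoly.natDegree_zero.symm)
  obtain ⟨a, ha, hxy⟩ := exists_eq_C_mul_add_val hf hdeg
  rw [associator_eq_neg_modr hxy, mul_assoc, modr_C_mul, neg_eq_zero, smul_eq_zero,
    modr_eq_zero_iff hf0] at hxyz
  exact hxyz.resolve_left ha

theorem mem_rightNucleus_of_mul_mem_span (hf : f ≠ 0) (hz : f * val z ∈ Ideal.span {f}) :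
    z ∈ rightNucleus (Petit f) := by
  intro x y
  obtain ⟨q, hq⟩ := modr_spec hf (val x * val y)
  rw [associator_eq_neg_modr hq, mul_assoc,
    modr_eq_zero_of_mem_span (Ideal.mul_mem_left _ q hz), neg_zero]

theorem rightNucleus_eq (hf : 2 ≤ f.natDegree) :
    rightNucleus (Petit f) = {z | f * val z ∈ Ideal.span {f}} := by
  have hf0 : f.natDegree ≠ 0 := by omega
  refine Set.Subset.antisymm (fun z hz => ?_) fun z => mem_rightNucleus_of_mul_mem_span
    (ne_of_apply_ne DiffPoly.natDegree (hf0.trans_eq DiffPoly.natDegree_zero.symm))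
  refine mul_val_mem_span_of_associator_eq_zero hf0 ?_
    (hz (modr f (DiffPoly.t δ ^ (f.natDegree - 1))) (modr f (DiffPoly.t δ)))
  rw [val_modr_of_natDegree_lt (by rw [DiffPoly.natDegree_t_pow]; omega),
    val_modr_of_natDegree_lt (by rw [DiffPoly.natDegree_t]; omega), ← pow_succ,
    DiffPoly.natDegree_t_pow]
  omega

theorem val_modr_C (hf : f.natDegree ≠ 0) (a : D) :
    val (modr f (DiffPoly.C δ a)) = DiffPoly.C δ a :=
  val_modr_of_natDegree_lt (by rw [DiffPoly.natDegree_C]; omega)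

theorem constants_subset_rightNucleus_iff (hf : 2 ≤ f.natDegree) :
    constants f ⊆ rightNucleus (Petit f) ↔ f.IsSemiInvariant := by
  rw [rightNucleus_eq hf, DiffPoly.isSemiInvariant_iff]
  refine ⟨fun h a => ?_, fun h z ⟨a, ha⟩ => ?_⟩
  · have hval := val_modr_C (f := f) (by omega) a
    exact hval ▸ h ⟨a, hval⟩
  · change f * val z ∈ Ideal.span {f}
    exact ha ▸ h a

theorem isTwoSided_of_forall_mul_val_mem_span (hf : 2 ≤ f.natDegree)
    (h : ∀ z : Petit f, f * val z ∈ Ideal.span {f}) : f.IsTwoSided := by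
  refine DiffPoly.isTwoSided_of_mul_mem_span (fun a => ?_) ?_
  · rw [← val_modr_C (f := f) (by omega) a]
    exact h _
  · rw [← val_modr_of_natDegree_lt (f := f) (g := DiffPoly.t δ)
      (by rw [DiffPoly.natDegree_t]; omega)]
    exact h _

theorem natDegree_val_eq_zero_iff : (val x).natDegree = 0 ↔ x ∈ constants f :=
  ⟨DiffPoly.exists_eq_C_of_natDegree_eq_zero, fun ⟨a, ha⟩ => by rw [ha, DiffPoly.natDegree_C]⟩

theorem exists_natDegree_mul_val_eq (hf : f.natDegree ≠ 0) (hx : x ∉ constants f) :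
    ∃ y : Petit f, (val x * val y).natDegree = f.natDegree ∧
      (val y * val x).natDegree = f.natDegree := by
  rw [← natDegree_val_eq_zero_iff] at hx
  have hx0 : val x ≠ 0 :=
    ne_of_apply_ne DiffPoly.natDegree (Ne.trans_eq hx DiffPoly.natDegree_zero.symm)
  have hxf := natDegree_val_lt hf x
  have ht0 (k : ℕ) : DiffPoly.t δ ^ k ≠ 0 := pow_ne_zero k DiffPoly.t_ne_zero
  refine ⟨modr f (DiffPoly.t δ ^ (f.natDegree - (val x).natDegree)), ?_⟩
  rw [val_modr_of_natDegree_lt (by rw [DiffPoly.natDegree_t_pow]; omega),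
    DiffPoly.natDegree_mul hx0 (ht0 _), DiffPoly.natDegree_mul (ht0 _) hx0,
    DiffPoly.natDegree_t_pow]
  omega

theorem leftNucleus_eq_constants (hf : 2 ≤ f.natDegree) (h : ¬ f.IsTwoSided) :
    leftNucleus (Petit f) = constants f := by
  have hf0 : f.natDegree ≠ 0 := by omega
  refine Set.Subset.antisymm (fun x hx => ?_) fun x hx y z => ?_
  · by_contra hxC
    obtain ⟨y, hxy, -⟩ := exists_natDegree_mul_val_eq hf0 hxC
    exact h (isTwoSided_of_forall_mul_val_mem_span hf fun z =>
      mul_val_mem_span_of_associator_eq_zero hf0 hxy (hx y z))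
  · refine associator_eq_zero_of_natDegree_lt ((DiffPoly.natDegree_mul_le _ _).trans_lt ?_)
    rw [natDegree_val_eq_zero_iff.mpr hx, zero_add]
    exact natDegree_val_lt hf0 y

theorem middleNucleus_eq_constants (hf : 2 ≤ f.natDegree) (h : ¬ f.IsTwoSided) :
    middleNucleus (Petit f) = constants f := by
  have hf0 : f.natDegree ≠ 0 := by omega
  refine Set.Subset.antisymm (fun x hx => ?_) fun x hx y z => ?_
  · by_contra hxC
    obtain ⟨y, -, hyx⟩ := exists_natDegree_mul_val_eq hf0 hxC
    exact h (isTwoSided_of_forall_mul_val_mem_span hf fun z =>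
      mul_val_mem_span_of_associator_eq_zero hf0 hyx (hx y z))
  · refine associator_eq_zero_of_natDegree_lt ((DiffPoly.natDegree_mul_le _ _).trans_lt ?_)
    rw [natDegree_val_eq_zero_iff.mpr hx, add_zero]
    exact natDegree_val_lt hf0 y

end Nuclei

section Division

variable {D : Type*} [DivisionRing D] {δ : RingDer D} {f g : DiffPoly δ}

variable (f g) in
/-- Right multiplication `R/Rg → R/Rf` by `a`; it is compatible with the projections from `R` when
`g a` lies in `Rf`. -/
noncomputable def mulRightModr (a : DiffPoly δ) : Petit g →ₗ[D] Petit f where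
  toFun y := modr f (val y * a)
  map_add' y z := by rw [map_add, add_mul, modr_add]
  map_smul' c y := by rw [val_smul, mul_assoc, modr_C_mul, RingHom.id_apply]

theorem mulRightModr_modr (hg : g ≠ 0) {a : DiffPoly δ} (hga : g * a ∈ Ideal.span {f})
    (h : DiffPoly δ) : mulRightModr f g a (modr g h) = modr f (h * a) := by
  obtain ⟨q, hq⟩ := modr_spec hg h
  have hqga : modr f (q * g * a) = 0 := by
    rw [mul_assoc]
    exact modr_eq_zero_of_mem_span (Ideal.mul_mem_left _ q hga)
  nth_rewrite 2 [hq]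
  rw [add_mul, modr_add, hqga, zero_add]
  rfl

theorem mulRightModr_surjective (hf : Irreducible f) (hg : g ≠ 0) {a : DiffPoly δ}
    (ha : a ∉ Ideal.span {f}) (hga : g * a ∈ Ideal.span {f}) :
    Function.Surjective (mulRightModr f g a) := by
  intro z
  obtain ⟨b, i, hi, hbi⟩ := (isMaximal_span_singleton_of_irreducible hf).exists_inv ha
  refine ⟨modr g (val z * b), ?_⟩
  have hzi := modr_eq_zero_of_mem_span (Ideal.mul_mem_left _ (val z) hi)
  rw [mulRightModr_modr hg hga, ← add_zero (modr f _), ← hzi, ← modr_add, mul_assoc, ← mul_add,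
    hbi, mul_one, modr_val]

theorem natDegree_le_of_mul_mem_span (hf : Irreducible f) (hg : g ≠ 0) {a : DiffPoly δ}
    (ha : a ∉ Ideal.span {f}) (hga : g * a ∈ Ideal.span {f}) : f.natDegree ≤ g.natDegree := by
  have hfinrank := LinearMap.finrank_le_finrank_of_surjective
    (mulRightModr_surjective hf hg ha hga)
  rwa [finrank_eq, finrank_eq, Module.finrank_self, mul_one, mul_one] at hfinrank

theorem noZeroDivisors_of_irreducible (hf : Irreducible f) : NoZeroDivisors (Petit f) where
  eq_zero_or_eq_zero_of_mul_eq_zero {x y} hxy := by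
    by_cases hf0 : f.natDegree = 0
    · have := subsingleton_of_natDegree hf0
      exact .inl (Subsingleton.elim x 0)
    by_contra! hxy0
    refine (natDegree_val_lt hf0 x).not_ge (natDegree_le_of_mul_mem_span hf
      (val_eq_zero_iff.not.mpr hxy0.1) (fun hy => hxy0.2 ?_)
      ((modr_eq_zero_iff hf.ne_zero).mp hxy))
    rw [← modr_val y, modr_eq_zero_of_mem_span hy]

theorem isNonassocDivision_of_irreducible [FiniteDimensional δ.constField D]
    (hf0 : f.natDegree ≠ 0) (hf : Irreducible f) : IsNonassocDivision (Petit f) :=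
  have := nontrivial hf0
  have := noZeroDivisors_of_irreducible hf
  have : FiniteDimensional δ.constField (Petit f) := finite δ.constField f
  isNonassocDivision_of_finiteDimensional δ.constField

end Division

end Petit

namespace Petit

section Map

variable {A D : Type*} [DivisionRing A] [DivisionRing D] {ε : RingDer A} {δ : RingDer D}
  {φ : A →+* D} (hφ : ∀ a, φ (ε a) = δ (φ a)) (f : DiffPoly ε)

theorem exists_val_eq_map_val (x : Petit f) :
    ∃ y : Petit (DiffPoly.map φ hφ f), val y = DiffPoly.map φ hφ (val x) := by
  refine ⟨mk ((val x).toPoly.map φ) ?_, rfl⟩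
  rw [mem_degreeLT, degree_map, DiffPoly.natDegree_map hφ φ.injective]
  exact mem_degreeLT.mp x.2

theorem val_modr_map (g : DiffPoly ε) :
    val (modr (DiffPoly.map φ hφ f) (DiffPoly.map φ hφ g)) =
      DiffPoly.map φ hφ (val (modr f g)) := by
  by_cases hf : f = 0
  · rw [modr_zero_left hf, modr_zero_left (by rw [hf, map_zero]), map_zero, map_zero, map_zero]
  obtain ⟨q, hq⟩ := modr_spec hf g
  obtain ⟨y, hy⟩ := exists_val_eq_map_val hφ f (modr f g)
  have hf' := (map_ne_zero_iff _ (DiffPoly.map_injective hφ φ.injective)).mpr hf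
  rw [← hy, modr_unique hf' (q := DiffPoly.map φ hφ q)]
  rw [hy, ← map_mul, ← map_add, ← hq]

theorem val_modr_map_val (x : Petit f) :
    val (modr (DiffPoly.map φ hφ f) (DiffPoly.map φ hφ (val x))) = DiffPoly.map φ hφ (val x) := by
  rw [val_modr_map, modr_val]

variable {S : Type*} [Semiring S] [Module S A] [IsScalarTower S A A] [Module S D]
  [IsScalarTower S D D] (hS : ∀ (c : S) a, φ (c • a) = c • φ a)

/-- The homomorphism `S_f → S_{φ(f)}` of Petit algebras induced by an `S`-linear homomorphism `φ` of
the coefficients that intertwines the derivations. -/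
noncomputable def map : Petit f →ₙₐ[S] Petit (DiffPoly.map φ hφ f) where
  toFun x := modr (DiffPoly.map φ hφ f) (DiffPoly.map φ hφ (val x))
  map_smul' c x := by
    have hcx : c • x = (c • (1 : A)) • x := (smul_one_smul A c x).symm
    have hC : DiffPoly.map φ hφ (DiffPoly.C ε (c • 1)) = DiffPoly.C δ (c • (1 : D)) := by
      rw [← φ.map_one, ← hS]
      exact Polynomial.map_C φ
    rw [hcx, val_smul, map_mul, hC, modr_C_mul, smul_one_smul, MonoidHom.id_apply]
  map_zero' := by rw [map_zero, map_zero, modr_zero]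
  map_add' x y := by rw [map_add, map_add, modr_add]
  map_mul' x y := by
    apply val_injective
    rw [val_modr_map_val, mul_def (modr _ _), val_modr_map_val, val_modr_map_val,
      ← RingHom.map_mul, val_modr_map]
    rfl

theorem val_map (x : Petit f) : val (map hφ f hS x) = DiffPoly.map φ hφ (val x) :=
  val_modr_map_val hφ f x

theorem map_one : map hφ f hS 1 = 1 :=
  val_injective <| by
    rw [val_map]
    change DiffPoly.map φ hφ (val (modr f 1)) = val (modr _ 1)
    rw [← val_modr_map, RingHom.map_one]

theorem map_injective : Function.Injective (map hφ f hS) := fun x y hxy =>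
  val_injective <| DiffPoly.map_injective hφ φ.injective <| by
    rw [← val_map hφ f hS, hxy, val_map]

end Map

section OfConst

variable {D : Type*} [DivisionRing D] {δ : RingDer D} (p : δ.constField[X])

theorem modr_ofConst_mul (q r : δ.constField[X]) :
    modr (DiffPoly.ofConst δ p) (DiffPoly.ofConst δ (q * r)) =
      modr (DiffPoly.ofConst δ p) (DiffPoly.ofConst δ q) *
        modr (DiffPoly.ofConst δ p) (DiffPoly.ofConst δ r) := by
  rw [DiffPoly.ofConst_mul, modr_mul_of_mul_mem_span]
  exact Ideal.mem_span_singleton'.mpr ⟨_, DiffPoly.commute_ofConst r p⟩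

theorem modr_ofConst_smul (c : δ.constField) (q : δ.constField[X]) :
    modr (DiffPoly.ofConst δ p) (DiffPoly.ofConst δ (c • q)) =
      c • modr (DiffPoly.ofConst δ p) (DiffPoly.ofConst δ q) := by
  have hC : DiffPoly.ofConst δ (Polynomial.C c) = DiffPoly.C δ c := Polynomial.map_C _
  rw [smul_eq_C_mul, DiffPoly.ofConst_mul, hC, modr_C_mul]
  rfl

theorem modr_ofConst_eq_zero_of_mem_span {q : δ.constField[X]} (hq : q ∈ Ideal.span {p}) :
    modr (DiffPoly.ofConst δ p) (DiffPoly.ofConst δ q) = 0 := by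
  obtain ⟨s, rfl⟩ := Ideal.mem_span_singleton'.mp hq
  rw [DiffPoly.ofConst_mul, modr_mul_self]

/-- The homomorphism `F[t]/(p) → S_p`, `q + (p) ↦ q mod_r p`, for `p ∈ F[t]`. -/
noncomputable def ofConst :
    (δ.constField[X] ⧸ Ideal.span {p}) →ₙₐ[δ.constField] Petit (DiffPoly.ofConst δ p) where
  __ := QuotientAddGroup.lift (Ideal.span {p}).toAddSubgroup
    { toFun q := modr (DiffPoly.ofConst δ p) (DiffPoly.ofConst δ q)
      map_zero' := modr_ofConst_eq_zero_of_mem_span p (Ideal.zero_mem _)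
      map_add' q r := by rw [DiffPoly.ofConst_add, modr_add] }
    fun _ => modr_ofConst_eq_zero_of_mem_span p
  map_smul' c x := by
    obtain ⟨q, rfl⟩ := Ideal.Quotient.mk_surjective x
    exact modr_ofConst_smul p c q
  map_mul' x y := by
    obtain ⟨q, rfl⟩ := Ideal.Quotient.mk_surjective x
    obtain ⟨r, rfl⟩ := Ideal.Quotient.mk_surjective y
    exact modr_ofConst_mul p q r

theorem ofConst_mk (q : δ.constField[X]) :
    ofConst p (Ideal.Quotient.mk (Ideal.span {p}) q) =
      modr (DiffPoly.ofConst δ p) (DiffPoly.ofConst δ q) :=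
  rfl

theorem ofConst_one : ofConst p 1 = 1 :=
  congrArg (modr (DiffPoly.ofConst δ p)) DiffPoly.ofConst_one

theorem val_modr_ofConst (hp : p.natDegree ≠ 0) (q : δ.constField[X]) :
    val (modr (DiffPoly.ofConst δ p) (DiffPoly.ofConst δ q)) = DiffPoly.ofConst δ (q % p) := by
  have hdeg : (DiffPoly.ofConst δ (q % p)).natDegree < (DiffPoly.ofConst δ p).natDegree := by
    rw [DiffPoly.natDegree_ofConst, DiffPoly.natDegree_ofConst]
    exact natDegree_mod_lt q hp
  nth_rewrite 1 [← EuclideanDomain.div_add_mod' q p]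
  rw [DiffPoly.ofConst_add, DiffPoly.ofConst_mul, modr_add, modr_mul_self, zero_add,
    val_modr_of_natDegree_lt hdeg]

variable {p}

theorem ofConst_injective (hp : p.natDegree ≠ 0) : Function.Injective (ofConst p) := by
  refine (injective_iff_map_eq_zero _).mpr fun x hx => ?_
  obtain ⟨q, rfl⟩ := Ideal.Quotient.mk_surjective x
  rw [ofConst_mk, ← val_eq_zero_iff, val_modr_ofConst p hp, ← DiffPoly.ofConst_zero,
    DiffPoly.ofConst_injective.eq_iff, EuclideanDomain.mod_eq_zero] at hx
  exact Ideal.Quotient.eq_zero_iff_dvd p q |>.mpr hx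

theorem range_ofConst (hp : p.natDegree ≠ 0) :
    Set.range (ofConst p) = {x | ∃ r : δ.constField[X], val x = DiffPoly.ofConst δ r} := by
  refine Set.Subset.antisymm (Set.range_subset_iff.mpr fun y => ?_) fun x ⟨r, hr⟩ => ?_
  · obtain ⟨q, rfl⟩ := Ideal.Quotient.mk_surjective y
    exact ⟨q % p, val_modr_ofConst p hp q⟩
  · exact ⟨Ideal.Quotient.mk _ r, by rw [ofConst_mk, ← hr, modr_val]⟩

theorem range_ofConst_subset_rightNucleus (hp : p.natDegree ≠ 0) :
    Set.range (ofConst p) ⊆ rightNucleus (Petit (DiffPoly.ofConst δ p)) := by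
  have hp0 : DiffPoly.ofConst δ p ≠ 0 := ne_of_apply_ne DiffPoly.natDegree <| by
    rwa [DiffPoly.natDegree_ofConst, DiffPoly.natDegree_zero]
  rw [range_ofConst hp]
  rintro x ⟨r, hr⟩
  refine mem_rightNucleus_of_mul_mem_span hp0 (hr ▸ ?_)
  exact Ideal.mem_span_singleton'.mpr ⟨_, DiffPoly.commute_ofConst r p⟩

end OfConst

end Petit

theorem mainTheorem5_general {D : Type*} [DivisionRing D] [FiniteDimensional (Subring.center D) D]
    (δ : RingDer D) (hδ : IsAlgebraic δ.constField δ.centerLin)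
    (f : DiffPoly δ) (hf : 2 ≤ f.natDegree) :
    (IsScalarTower δ.constField (Petit f) (Petit f) ∧
      SMulCommClass δ.constField (Petit f) (Petit f) ∧
      Petit.val (1 : Petit f) = 1 ∧
      Module.finrank δ.constField (Petit f) = f.natDegree * Module.finrank (Subring.center D) D *
        (minpoly δ.constField δ.centerLin).natDegree) ∧
    (Irreducible f → IsNonassocDivision (Petit f)) ∧
    (¬ f.IsTwoSided →
      leftNucleus (Petit f) = Petit.constants f ∧ middleNucleus (Petit f) = Petit.constants f) ∧
    (Petit.constants f ⊆ rightNucleus (Petit f) ↔ f.IsSemiInvariant) ∧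
    (∀ f₀ : (δ.constField)[X], f = DiffPoly.ofConst δ f₀ →
      (∃ φ : ((δ.constField)[X] ⧸ Ideal.span {f₀}) →ₙₐ[δ.constField] Petit f,
        Function.Injective φ ∧ φ 1 = 1 ∧
        (∀ q : (δ.constField)[X],
          φ (Ideal.Quotient.mk (Ideal.span {f₀}) q) = Petit.modr f (DiffPoly.ofConst δ q)) ∧
        Set.range φ = {x | ∃ r : (δ.constField)[X], Petit.val x = DiffPoly.ofConst δ r} ∧
        Set.range φ ⊆ rightNucleus (Petit f)) ∧
      (Irreducible f₀ → IsField ((δ.constField)[X] ⧸ Ideal.span {f₀}) ∧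
        Module.finrank δ.constField ((δ.constField)[X] ⧸ Ideal.span {f₀}) = f.natDegree)) ∧
    (∀ f₁ : DiffPoly δ.toCenter, f = DiffPoly.ofCenter δ f₁ →
      (∃ ψ : Petit f₁ →ₙₐ[δ.constField] Petit f,
        Function.Injective ψ ∧ ψ 1 = 1 ∧
        ∀ x : Petit f₁, Petit.val (ψ x) = DiffPoly.ofCenter δ (Petit.val x)) ∧
      Module.finrank δ.constField (Petit f₁) =
        f.natDegree * (minpoly δ.constField δ.centerLin).natDegree) := by
  have hf0 : f.natDegree ≠ 0 := by omega
  have hC := δ.finiteDimensional_center hδ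
  have hD : FiniteDimensional δ.constField D := .trans δ.constField (Subring.center D) D
  refine ⟨⟨inferInstance, inferInstance, Petit.val_modr_one hf0, ?_⟩,
    Petit.isNonassocDivision_of_irreducible hf0,
    fun h => ⟨Petit.leftNucleus_eq_constants hf h, Petit.middleNucleus_eq_constants hf h⟩,
    Petit.constants_subset_rightNucleus_iff hf, ?_, ?_⟩
  · refine (Petit.finrank_eq δ.constField f).trans ?_
    rw [← Module.finrank_mul_finrank δ.constField (Subring.center D) D, δ.finrank_center hδ,
      mul_comm (minpoly _ _).natDegree, mul_assoc]
  · rintro f₀ rfl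
    rw [DiffPoly.natDegree_ofConst] at hf0 ⊢
    exact ⟨⟨Petit.ofConst f₀, Petit.ofConst_injective hf0, Petit.ofConst_one f₀,
      Petit.ofConst_mk f₀, Petit.range_ofConst hf0, Petit.range_ofConst_subset_rightNucleus hf0⟩,
      fun hirr => ⟨(Ideal.Quotient.maximal_ideal_iff_isField_quotient _).mp
        (PrincipalIdealRing.isMaximal_of_irreducible hirr), finrank_quotient_span_eq_natDegree⟩⟩
  · rintro f₁ rfl
    refine ⟨⟨Petit.map (fun _ => rfl) f₁ fun _ _ => rfl, Petit.map_injective _ f₁ _,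
      Petit.map_one _ f₁ _, Petit.val_map _ f₁ _⟩, (Petit.finrank_eq δ.constField f₁).trans ?_⟩
    rw [δ.finrank_center hδ]
    exact congrArg (· * _)
      (DiffPoly.natDegree_map (fun _ => rfl) Subtype.val_injective f₁).symm

theorem mainTheorem5 {D : Type*} [DivisionRing D] (p : ℕ) [Fact p.Prime] [CharP D p]
    (n e m : ℕ) [FiniteDimensional (Subring.center D) D]
    (hn : Module.finrank (Subring.center D) D = n ^ 2)
    (δ : RingDer D) (hδ : IsAlgebraic δ.constField δ.centerLin)
    (hdeg : (minpoly δ.constField δ.centerLin).natDegree = p ^ e)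
    (f : DiffPoly δ) (hf : f.natDegree = m) (hm : 2 ≤ m) :
    -- `S_f` is a unital algebra over `F` of dimension `m n² pᵉ`
    (IsScalarTower δ.constField (Petit f) (Petit f) ∧
      SMulCommClass δ.constField (Petit f) (Petit f) ∧
      Petit.val (1 : Petit f) = 1 ∧
      Module.finrank δ.constField (Petit f) = m * n ^ 2 * p ^ e) ∧
    (Irreducible f → IsNonassocDivision (Petit f)) ∧
    (¬ f.IsTwoSided →
      leftNucleus (Petit f) = Petit.constants f ∧ middleNucleus (Petit f) = Petit.constants f) ∧
    (Petit.constants f ⊆ rightNucleus (Petit f) ↔ f.IsSemiInvariant) ∧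
    -- the case `f ∈ F[t]`
    (∀ f₀ : (δ.constField)[X], f = DiffPoly.ofConst δ f₀ →
      (∃ φ : ((δ.constField)[X] ⧸ Ideal.span {f₀}) →ₙₐ[δ.constField] Petit f,
        Function.Injective φ ∧ φ 1 = 1 ∧
        (∀ q : (δ.constField)[X],
          φ (Ideal.Quotient.mk (Ideal.span {f₀}) q) = Petit.modr f (DiffPoly.ofConst δ q)) ∧
        Set.range φ = {x | ∃ r : (δ.constField)[X], Petit.val x = DiffPoly.ofConst δ r} ∧
        Set.range φ ⊆ rightNucleus (Petit f)) ∧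
      (Irreducible f₀ → IsField ((δ.constField)[X] ⧸ Ideal.span {f₀}) ∧
        Module.finrank δ.constField ((δ.constField)[X] ⧸ Ideal.span {f₀}) = m)) ∧
    -- the case `f ∈ C[t;δ]`
    (∀ f₁ : DiffPoly δ.toCenter, f = DiffPoly.ofCenter δ f₁ →
      (∃ ψ : Petit f₁ →ₙₐ[δ.constField] Petit f,
        Function.Injective ψ ∧ ψ 1 = 1 ∧
        ∀ x : Petit f₁, Petit.val (ψ x) = DiffPoly.ofCenter δ (Petit.val x)) ∧
      Module.finrank δ.constField (Petit f₁) = m * p ^ e) := by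
  subst hf
  simpa only [hn, hdeg] using mainTheorem5_general δ hδ f hm
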